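/- Let $\mathbb{D}=\{z\in\mathbb{C}:|z|<1\}$, let $dA=\frac1\pi\,dx\,dy$ be the normalized area measure on $\mathbb{D}$, and let $g\in L^p(\mathbb{D})=L^p(\mathbb{D},dA)$ be complex-valued, where $3/2<p<\infty$. Let $$G[g](z)=\int_{\mathbb{D}}\log\left|\frac{z-\tau}{1-\bar z\tau}\right|^2 g(\tau)\,dA(\tau),\qquad z\in\mathbb{D},$$ be the Green potential of $g$ (the integral converges absolutely for every $z\in\mathbb{D}$). Then: (1) if $3/2<p<2$, then $G[g]\in C^{\mu}(\mathbb{D})$ with $\mu=2/p-1$, that is, $G[g]$ is continuous on $\mathbb{D}$ and $$\sup_{z,w\in\mathbb{D},\,z\ne w}\frac{|G[g](z)-G[g](w)|}{|z-w|^{\mu}}<\infty;$$ (2) if $2<p<\infty$, then $G[g]\in C^{1,\nu}(\mathbb{D})$ with $\nu=1-2/p$, that is, $G[g]$ is continuously (real) differentiable on $\mathbb{D}$ and $$\sup_{z,w\in\mathbb{D},\,z\ne w}\frac{|\nabla G[g](z)-\nabla G[g](w)|}{|z-w|^{\nu}}<\infty .$$ -/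

import Mathlib

open MeasureTheory
open scoped NNReal ENNReal ComplexConjugate

noncomputable section

/-- The open unit disk of the complex plane. -/
def unitDisk : Set ℂ := Metric.ball 0 1

/-- The normalized area measure `dA = dx dy / π`, restricted to the unit disk. -/
def diskArea : Measure ℂ := (ENNReal.ofReal Real.pi)⁻¹ • (volume.restrict unitDisk)

/-- The Green function of the unit disk, `G(z, τ) = log |(z - τ) / (1 - z̄ τ)| ^ 2`. -/
def greenFunction (z τ : ℂ) : ℝ := Real.log (‖(z - τ) / (1 - conj z * τ)‖ ^ 2)

/-- The Green potential `G[g](z) = ∫ G(z, τ) g(τ) dA(τ)`, the integral being over the unit disk. -/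
def greenPotential (g : ℂ → ℂ) (z : ℂ) : ℂ := ∫ τ, (greenFunction z τ : ℂ) * g τ ∂diskArea

/-- `f` belongs to the Hölder space `C^μ` of the unit disk (`0 < μ ≤ 1`): it is continuous there,
and `|f z - f w| ≤ C |z - w| ^ μ` on the disk for some finite constant `C`. -/
def MemDiskHolder (μ : ℝ) (f : ℂ → ℂ) : Prop :=
  ContinuousOn f unitDisk ∧ ∃ C : ℝ≥0, HolderOnWith C μ.toNNReal f unitDisk

/-- `f` belongs to the space `C^{1,ν}` of the unit disk (`0 < ν ≤ 1`): it is `C^1` there in the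
real sense, and its real derivative satisfies a Hölder condition of exponent `ν` on the disk.
The norm on derivatives is the operator norm, that is `|f_z| + |f_z̄|`. -/
def MemDiskC1Holder (ν : ℝ) (f : ℂ → ℂ) : Prop :=
  ContDiffOn ℝ 1 f unitDisk ∧ ∃ C : ℝ≥0, HolderOnWith C ν.toNNReal (fderiv ℝ f) unitDisk

end

/-! Off the diagonal the Green function is `2 log|z - τ| - 2 log|1 - z τ̄|`. Since `|z - τ| ≤ |1 - z
τ̄|` on the disk, every estimate of the first logarithm by negative powers of `|z - τ|` also holds
for the second, so no boundary analysis is needed. Each kernel bound is then paired with `g` by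
Hölder's inequality, `q` being the conjugate exponent; `|z - τ|^(-s)` is in `L^q`, uniformly in `z`,
when `s q < 2`.

For `p < 2`, the kernel increment is at most a constant times `|z - w|^α (|z - τ|^(-α) + |w -
τ|^(-α))`. This gives Hölder exponent `α` whenever `α q < 2`, that is `α < 2 - 2/p`, and `2/p - 1`
lies in that range.

For `p > 2`, i.e. `q < 2`, the Taylor remainder of the kernel is `O(|w - z|^(1+δ))` with integrable
singularities, which justifies differentiating under the integral. The derivative kernel has
increments bounded by `2|z - w| / (|z - τ||w - τ|)`. By scaling, the `L^q` norm of `1 / (|z - τ||w -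
τ|)` is `O(|z - w|^(2/q - 2))`, so the exponent is `2/q - 1 = 1 - 2/p`. -/

/-! ### Hölder and Taylor estimates for the logarithm -/

theorem log_one_add_le_rpow_div {t α : ℝ} (ht : 0 ≤ t) (hα : 0 < α) (hα1 : α ≤ 1) :
    Real.log (1 + t) ≤ t ^ α / α := by
  rw [le_div_iff₀ hα, mul_comm, ← Real.log_rpow (by linarith)]
  have h1 : (1 + t) ^ α ≤ 1 + t ^ α := by
    simpa using Real.rpow_add_le_add_rpow zero_le_one ht hα.le hα1
  have h2 := Real.log_le_sub_one_of_pos (Real.rpow_pos_of_pos (show 0 < 1 + t by linarith) α)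
  linarith

theorem abs_log_sub_log_le_rpow {a b α : ℝ} (ha : 0 < a) (hb : 0 < b) (hα : 0 < α)
    (hα1 : α ≤ 1) :
    |Real.log a - Real.log b| ≤ α⁻¹ * |a - b| ^ α * (a ^ (-α) + b ^ (-α)) := by
  wlog h : b ≤ a generalizing a b
  · have := this hb ha (le_of_not_ge h)
    rwa [abs_sub_comm, abs_sub_comm b a, add_comm (b ^ (-α))] at this
  have hab : 0 ≤ a - b := sub_nonneg.2 h
  have h0 : Real.log a - Real.log b = Real.log (1 + (a - b) / b) := by
    rw [← Real.log_div ha.ne' hb.ne']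
    congr 1
    field_simp
    ring
  have h1 : 0 ≤ Real.log a - Real.log b := sub_nonneg.2 (Real.log_le_log hb h)
  rw [abs_of_nonneg h1, abs_of_nonneg hab, h0]
  refine (log_one_add_le_rpow_div (by positivity) hα hα1).trans ?_
  rw [Real.div_rpow hab hb.le, Real.rpow_neg hb.le, Real.rpow_neg ha.le]
  have : 0 ≤ α⁻¹ * (a - b) ^ α * (a ^ α)⁻¹ := by positivity
  calc _ = α⁻¹ * (a - b) ^ α * (b ^ α)⁻¹ := by ring
    _ ≤ _ := by rw [mul_add]; linarith

/-- For `|v - 1| ≤ 1/2` the remainder is quadratic, hence below the power `1 + δ`. Farther away the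
logarithm and the linear term are each dominated separately, and `‖v‖ ^ (-δ)` absorbs the pole at `v
= 0`. -/
theorem abs_log_norm_sub_re_le {v : ℂ} (hv : v ≠ 0) {δ : ℝ} (hδ : 0 < δ) (hδ1 : δ ≤ 1) :
    |Real.log ‖v‖ - (v - 1).re| ≤
      2 * (δ⁻¹ + 1) * ‖v - 1‖ ^ (1 + δ) * (1 + ‖v‖ ^ (-δ)) := by
  obtain ⟨u, rfl⟩ : ∃ u, v = 1 + u := ⟨v - 1, by ring⟩
  rw [add_sub_cancel_left]
  have hv0 : 0 < ‖1 + u‖ := norm_pos_iff.2 hv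
  have hE : 0 ≤ ‖1 + u‖ ^ (-δ) := by positivity
  have hδi : 1 ≤ δ⁻¹ := (one_le_inv₀ hδ).2 hδ1
  have hU : 0 ≤ ‖u‖ ^ (1 + δ) := by positivity
  rcases le_or_gt ‖u‖ (1 / 2) with hu | hu
  · have h1 := Complex.norm_log_one_add_sub_self_le (show ‖u‖ < 1 by linarith)
    have h2 := (Complex.abs_re_le_norm _).trans h1
    rw [Complex.sub_re, Complex.log_re] at h2
    have h3 : (1 - ‖u‖)⁻¹ ≤ 2 := by
      rw [inv_le_comm₀ (by linarith) two_pos]; linarith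
    have h4 : ‖u‖ ^ 2 ≤ ‖u‖ ^ (1 + δ) := by
      rcases (norm_nonneg u).eq_or_lt with h0 | h0
      · rw [← h0, Real.zero_rpow (by linarith)]; norm_num
      · rw [← Real.rpow_natCast]
        exact Real.rpow_le_rpow_of_exponent_ge h0 (by linarith) (by push_cast; linarith)
    have h5 : ‖u‖ ^ 2 * (1 - ‖u‖)⁻¹ / 2 ≤ ‖u‖ ^ 2 := by
      have := mul_le_mul_of_nonneg_left h3 (sq_nonneg ‖u‖)
      linarith
    calc _ ≤ ‖u‖ ^ (1 + δ) := by linarith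
      _ = 1 * ‖u‖ ^ (1 + δ) * 1 := by ring
      _ ≤ _ := by gcongr <;> linarith
  · have hu0 : 0 < ‖u‖ := by linarith
    have h1 := abs_log_sub_log_le_rpow hv0 one_pos hδ hδ1
    have h2 : |‖1 + u‖ - 1| ≤ ‖u‖ := by
      simpa using abs_norm_sub_norm_le (1 + u) 1
    have h3 : |‖1 + u‖ - 1| ^ δ ≤ ‖u‖ ^ δ := Real.rpow_le_rpow (abs_nonneg _) h2 hδ.le
    have h4 : ‖u‖ ^ (1 + δ) = ‖u‖ * ‖u‖ ^ δ := by rw [Real.rpow_add hu0, Real.rpow_one]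
    have h5 : ‖u‖ ^ δ ≤ 2 * ‖u‖ ^ (1 + δ) := by
      rw [h4]
      have : 0 ≤ ‖u‖ ^ δ := by positivity
      nlinarith
    have h6 : ‖u‖ ≤ 2 * ‖u‖ ^ (1 + δ) := by
      have : 1 / 2 ≤ ‖u‖ ^ δ := by
        calc (1 / 2 : ℝ) = (1 / 2) ^ (1 : ℝ) := by simp
          _ ≤ (1 / 2) ^ δ := Real.rpow_le_rpow_of_exponent_ge (by norm_num) (by norm_num) hδ1
          _ ≤ ‖u‖ ^ δ := Real.rpow_le_rpow (by norm_num) hu.le hδ.le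
      rw [h4]
      nlinarith
    have h7 := (Complex.abs_re_le_norm u).trans h6
    rw [Real.log_one, sub_zero, Real.one_rpow] at h1
    calc _ ≤ |Real.log ‖1 + u‖| + |u.re| := abs_sub _ _
      _ ≤ δ⁻¹ * (2 * ‖u‖ ^ (1 + δ)) * (‖1 + u‖ ^ (-δ) + 1) + 2 * ‖u‖ ^ (1 + δ) * 1 := by
        rw [mul_one]
        refine add_le_add (h1.trans ?_) h7
        gcongr
        exact h3.trans h5
      _ ≤ δ⁻¹ * (2 * ‖u‖ ^ (1 + δ)) * (‖1 + u‖ ^ (-δ) + 1) +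
          2 * ‖u‖ ^ (1 + δ) * (‖1 + u‖ ^ (-δ) + 1) := by gcongr; linarith
      _ = _ := by ring

/-- The first order Taylor remainder of `log ‖·‖`, in a form that is integrable in both
singularities. -/
theorem abs_log_norm_sub_log_norm_sub_re_le {a b : ℂ} (ha : a ≠ 0) (hb : b ≠ 0) {δ : ℝ}
    (hδ : 0 < δ) (hδ1 : δ ≤ 1) :
    |Real.log ‖b‖ - Real.log ‖a‖ - ((b - a) / a).re| ≤
      4 * (δ⁻¹ + 1) * ‖b - a‖ ^ (1 + δ) * (‖a‖ ^ (-(1 + δ)) + ‖b‖ ^ (-(1 + δ))) := by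
  -- Homogeneity reduces the claim to the expansion at `1`, with `v = b / a`.
  have h := abs_log_norm_sub_re_le (div_ne_zero hb ha) hδ hδ1
  have ha0 : 0 < ‖a‖ := norm_pos_iff.2 ha
  have hb0 : 0 < ‖b‖ := norm_pos_iff.2 hb
  rw [div_sub_one ha, norm_div, norm_div, Real.log_div hb0.ne' ha0.ne'] at h
  refine h.trans ?_
  have h1 : ‖a‖ ^ (-(1 + δ)) * (‖b‖ / ‖a‖) ^ (-δ) = ‖a‖⁻¹ * ‖b‖ ^ (-δ) := by
    rw [Real.div_rpow hb0.le ha0.le, show -(1 + δ) = -δ + -1 by ring, Real.rpow_add ha0,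
      Real.rpow_neg_one]
    have : ‖a‖ ^ (-δ) ≠ 0 := by positivity
    field_simp
  have h2 : ‖a‖⁻¹ * ‖b‖ ^ (-δ) ≤ ‖a‖ ^ (-(1 + δ)) + ‖b‖ ^ (-(1 + δ)) := by
    have e : ∀ x : ℝ, 0 < x → x⁻¹ * x ^ (-δ) = x ^ (-(1 + δ)) := fun x hx => by
      rw [← Real.rpow_neg_one, ← Real.rpow_add hx]; congr 1; ring
    have p1 : 0 ≤ ‖a‖ ^ (-(1 + δ)) := by positivity
    have p2 : 0 ≤ ‖b‖ ^ (-(1 + δ)) := by positivity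
    rcases le_total ‖a‖ ‖b‖ with hab | hab
    · have : ‖b‖ ^ (-δ) ≤ ‖a‖ ^ (-δ) :=
        Real.rpow_le_rpow_of_nonpos ha0 hab (by linarith)
      have := mul_le_mul_of_nonneg_left this (inv_nonneg.2 ha0.le)
      rw [e _ ha0] at this
      linarith
    · have : ‖a‖⁻¹ ≤ ‖b‖⁻¹ := inv_anti₀ hb0 hab
      have := mul_le_mul_of_nonneg_right this (show 0 ≤ ‖b‖ ^ (-δ) by positivity)
      rw [e _ hb0] at this
      linarith
  have h3 : (‖b - a‖ / ‖a‖) ^ (1 + δ) * (1 + (‖b‖ / ‖a‖) ^ (-δ)) =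
      ‖b - a‖ ^ (1 + δ) * (‖a‖ ^ (-(1 + δ)) + ‖a‖⁻¹ * ‖b‖ ^ (-δ)) := by
    rw [← h1, Real.div_rpow (norm_nonneg _) ha0.le, Real.rpow_neg ha0.le]
    ring
  have p3 : 0 ≤ ‖b‖ ^ (-(1 + δ)) := by positivity
  calc _ = 2 * (δ⁻¹ + 1) * ((‖b - a‖ / ‖a‖) ^ (1 + δ) * (1 + (‖b‖ / ‖a‖) ^ (-δ))) := by ring
    _ = 2 * (δ⁻¹ + 1) * (‖b - a‖ ^ (1 + δ) * (‖a‖ ^ (-(1 + δ)) + ‖a‖⁻¹ * ‖b‖ ^ (-δ))) := by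
      rw [h3]
    _ ≤ 2 * (δ⁻¹ + 1) * (‖b - a‖ ^ (1 + δ) *
        (2 * (‖a‖ ^ (-(1 + δ)) + ‖b‖ ^ (-(1 + δ))))) := by gcongr; linarith
    _ = _ := by ring

/-! ### Pointwise bounds for the Green kernel and its derivative -/

/-- The difference of the squares is `(1 - |z|²)(1 - |τ|²)`. This lets the reflected term be treated
like the singular one. -/
theorem norm_sub_le_norm_one_sub_mul_conj {z τ : ℂ} (hz : z ∈ unitDisk) (hτ : τ ∈ unitDisk) :
    ‖z - τ‖ ≤ ‖1 - z * conj τ‖ := by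
  have hz' : ‖z‖ < 1 := by simpa [unitDisk] using hz
  have hτ' : ‖τ‖ < 1 := by simpa [unitDisk] using hτ
  rw [← sq_le_sq₀ (norm_nonneg _) (norm_nonneg _), Complex.sq_norm, Complex.sq_norm]
  have h1 : Complex.normSq z < 1 := by
    rw [← Complex.sq_norm]; nlinarith [norm_nonneg z]
  have h2 : Complex.normSq τ < 1 := by
    rw [← Complex.sq_norm]; nlinarith [norm_nonneg τ]
  have : Complex.normSq (1 - z * conj τ) - Complex.normSq (z - τ) =
      (1 - Complex.normSq z) * (1 - Complex.normSq τ) := by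
    simp [Complex.normSq_apply]
    ring
  nlinarith

theorem one_sub_mul_conj_ne_zero {z τ : ℂ} (hz : z ∈ unitDisk) (hτ : τ ∈ unitDisk) :
    1 - z * conj τ ≠ 0 := by
  have hz' : ‖z‖ < 1 := by simpa [unitDisk] using hz
  have hτ' : ‖τ‖ < 1 := by simpa [unitDisk] using hτ
  intro h
  have : ‖z * conj τ‖ = 1 := by rw [← sub_eq_zero.1 h, norm_one]
  rw [norm_mul, RCLike.norm_conj] at this
  nlinarith [norm_nonneg z, norm_nonneg τ]

theorem greenFunction_eq {z τ : ℂ} (hz : z ∈ unitDisk) (hτ : τ ∈ unitDisk) (h : τ ≠ z) :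
    greenFunction z τ = 2 * Real.log ‖z - τ‖ - 2 * Real.log ‖1 - z * conj τ‖ := by
  have e : ‖1 - conj z * τ‖ = ‖1 - z * conj τ‖ := by
    rw [← RCLike.norm_conj]; simp
  have h1 : ‖z - τ‖ ≠ 0 := norm_ne_zero_iff.2 (sub_ne_zero.2 h.symm)
  have h2 : ‖1 - z * conj τ‖ ≠ 0 := norm_ne_zero_iff.2 (one_sub_mul_conj_ne_zero hz hτ)
  rw [greenFunction, norm_div, e, Real.log_pow, Real.log_div h1 h2]
  push_cast
  ring

/-- Any small power beats the logarithm; `1/2` is chosen because `q / 2 < 2` for `q < 3`. -/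
theorem abs_greenFunction_le {z τ : ℂ} (hz : z ∈ unitDisk) (hτ : τ ∈ unitDisk) (h : τ ≠ z) :
    |greenFunction z τ| ≤ 8 * ‖z - τ‖ ^ (-(1 / 2) : ℝ) := by
  have h0 : 0 < ‖z - τ‖ := norm_pos_iff.2 (sub_ne_zero.2 h.symm)
  have hle := norm_sub_le_norm_one_sub_mul_conj hz hτ
  have h1 : 0 < ‖1 - z * conj τ‖ := h0.trans_le hle
  have h2 : ‖1 - z * conj τ‖ ≤ 2 := by
    have hz' : ‖z‖ < 1 := by simpa [unitDisk] using hz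
    have hτ' : ‖τ‖ < 1 := by simpa [unitDisk] using hτ
    refine (norm_sub_le _ _).trans ?_
    rw [norm_mul, RCLike.norm_conj, norm_one]
    nlinarith [norm_nonneg z, norm_nonneg τ]
  have hl := Real.log_le_log h0 hle
  rw [greenFunction_eq hz hτ h, abs_of_nonpos (by linarith)]
  have h3 : Real.log (‖1 - z * conj τ‖ / ‖z - τ‖) ≤
      (‖1 - z * conj τ‖ / ‖z - τ‖) ^ (1 / 2 : ℝ) / (1 / 2) :=
    Real.log_le_rpow_div (by positivity) (by norm_num)
  rw [Real.log_div h1.ne' h0.ne', Real.div_rpow h1.le h0.le] at h3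
  have h4 : ‖1 - z * conj τ‖ ^ (1 / 2 : ℝ) ≤ 2 := by
    calc _ ≤ (2 : ℝ) ^ (1 / 2 : ℝ) := Real.rpow_le_rpow h1.le h2 (by norm_num)
      _ ≤ 2 ^ (1 : ℝ) := Real.rpow_le_rpow_of_exponent_le (by norm_num) (by norm_num)
      _ = 2 := by simp
  rw [Real.rpow_neg h0.le]
  have h5 : 0 ≤ (‖z - τ‖ ^ (1 / 2 : ℝ))⁻¹ := by positivity
  have h6 := mul_le_mul_of_nonneg_right h4 h5
  rw [← div_eq_mul_inv] at h6
  linarith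

theorem norm_one_sub_sub_le (z w : ℂ) {τ : ℂ} (hτ : τ ∈ unitDisk) :
    ‖(1 - w * conj τ) - (1 - z * conj τ)‖ ≤ ‖w - z‖ := by
  have hτ' : ‖τ‖ < 1 := by simpa [unitDisk] using hτ
  rw [show (1 - w * conj τ) - (1 - z * conj τ) = -((w - z) * conj τ) by ring, norm_neg, norm_mul,
    RCLike.norm_conj]
  exact mul_le_of_le_one_right (norm_nonneg _) hτ'.le

theorem abs_greenFunction_sub_le {z w τ : ℂ} (hz : z ∈ unitDisk) (hw : w ∈ unitDisk)
    (hτ : τ ∈ unitDisk) (hτz : τ ≠ z) (hτw : τ ≠ w) {α : ℝ} (hα : 0 < α) (hα1 : α ≤ 1) :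
    |greenFunction z τ - greenFunction w τ| ≤
      4 * α⁻¹ * ‖z - w‖ ^ α * (‖z - τ‖ ^ (-α) + ‖w - τ‖ ^ (-α)) := by
  have z0 : 0 < ‖z - τ‖ := norm_pos_iff.2 (sub_ne_zero.2 hτz.symm)
  have w0 : 0 < ‖w - τ‖ := norm_pos_iff.2 (sub_ne_zero.2 hτw.symm)
  have hzle := norm_sub_le_norm_one_sub_mul_conj hz hτ
  have hwle := norm_sub_le_norm_one_sub_mul_conj hw hτ
  have h1 := abs_log_sub_log_le_rpow z0 w0 hα hα1
  have h2 := abs_log_sub_log_le_rpow (z0.trans_le hzle) (w0.trans_le hwle) hα hα1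
  have d1 : |‖z - τ‖ - ‖w - τ‖| ≤ ‖z - w‖ := by
    simpa using abs_norm_sub_norm_le (z - τ) (w - τ)
  have d2 : |‖1 - z * conj τ‖ - ‖1 - w * conj τ‖| ≤ ‖z - w‖ :=
    (abs_norm_sub_norm_le _ _).trans (norm_one_sub_sub_le w z hτ)
  have h3 : |Real.log ‖z - τ‖ - Real.log ‖w - τ‖| ≤
      α⁻¹ * ‖z - w‖ ^ α * (‖z - τ‖ ^ (-α) + ‖w - τ‖ ^ (-α)) := h1.trans (by gcongr)
  have h4 : |Real.log ‖1 - z * conj τ‖ - Real.log ‖1 - w * conj τ‖| ≤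
      α⁻¹ * ‖z - w‖ ^ α * (‖z - τ‖ ^ (-α) + ‖w - τ‖ ^ (-α)) := by
    refine h2.trans ?_
    gcongr α⁻¹ * ?_ * (?_ + ?_)
    · exact Real.rpow_le_rpow (abs_nonneg _) d2 hα.le
    · exact Real.rpow_le_rpow_of_nonpos z0 hzle (by linarith)
    · exact Real.rpow_le_rpow_of_nonpos w0 hwle (by linarith)
  rw [greenFunction_eq hz hτ hτz, greenFunction_eq hw hτ hτw]
  rw [abs_le] at h3 h4 ⊢
  constructor <;> linarith [h3.1, h3.2, h4.1, h4.2]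

/-- The Wirtinger derivative `∂G(z, τ)/∂z` of the Green function. -/
noncomputable def greenDz (z τ : ℂ) : ℂ := (z - τ)⁻¹ + conj τ / (1 - z * conj τ)

theorem norm_conj_div_le {z τ : ℂ} (hz : z ∈ unitDisk) (hτ : τ ∈ unitDisk) (hτz : τ ≠ z) :
    ‖conj τ / (1 - z * conj τ)‖ ≤ ‖z - τ‖⁻¹ := by
  have z0 : 0 < ‖z - τ‖ := norm_pos_iff.2 (sub_ne_zero.2 hτz.symm)
  have hτ' : ‖τ‖ < 1 := by simpa [unitDisk] using hτ
  rw [norm_div, RCLike.norm_conj, div_eq_mul_inv]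
  calc _ ≤ 1 * ‖z - τ‖⁻¹ := by
        gcongr
        exact norm_sub_le_norm_one_sub_mul_conj hz hτ
    _ = _ := one_mul _

theorem norm_greenDz_le {z τ : ℂ} (hz : z ∈ unitDisk) (hτ : τ ∈ unitDisk) (hτz : τ ≠ z) :
    ‖greenDz z τ‖ ≤ 2 * ‖z - τ‖ ^ (-1 : ℝ) := by
  refine (norm_add_le _ _).trans ?_
  have := norm_conj_div_le hz hτ hτz
  rw [norm_inv, Real.rpow_neg_one]
  linarith

/-- Both summands of `greenDz` obey a resolvent identity: the increment is `±(z - w)` times the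
product of the values at `z` and `w`. -/
theorem norm_greenDz_sub_le {z w τ : ℂ} (hz : z ∈ unitDisk) (hw : w ∈ unitDisk)
    (hτ : τ ∈ unitDisk) (hτz : τ ≠ z) (hτw : τ ≠ w) :
    ‖greenDz z τ - greenDz w τ‖ ≤ 2 * ‖z - w‖ * (‖z - τ‖⁻¹ * ‖w - τ‖⁻¹) := by
  have z0 : z - τ ≠ 0 := sub_ne_zero.2 hτz.symm
  have w0 : w - τ ≠ 0 := sub_ne_zero.2 hτw.symm
  have z1 := one_sub_mul_conj_ne_zero hz hτ
  have w1 := one_sub_mul_conj_ne_zero hw hτ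
  have e : greenDz z τ - greenDz w τ = -((z - w) * ((z - τ)⁻¹ * (w - τ)⁻¹)) +
      (z - w) * ((conj τ / (1 - z * conj τ)) * (conj τ / (1 - w * conj τ))) := by
    have e1 : (z - τ)⁻¹ - (w - τ)⁻¹ = -((z - w) * ((z - τ)⁻¹ * (w - τ)⁻¹)) := by
      field_simp
      ring
    have e2 : conj τ / (1 - z * conj τ) - conj τ / (1 - w * conj τ) =
        (z - w) * ((conj τ / (1 - z * conj τ)) * (conj τ / (1 - w * conj τ))) := by
      rw [div_sub_div _ _ z1 w1, div_mul_div_comm, mul_div_assoc']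
      congr 1
      ring
    rw [← e1, ← e2, greenDz, greenDz]
    ring
  rw [e]
  refine (norm_add_le _ _).trans ?_
  rw [norm_neg, norm_mul, norm_mul, norm_mul (z - w), norm_mul (_ / _), norm_inv, norm_inv]
  have h1 := norm_conj_div_le hz hτ hτz
  have h2 := norm_conj_div_le hw hτ hτw
  have := mul_le_mul_of_nonneg_left (mul_le_mul h1 h2 (norm_nonneg _) (by positivity))
    (norm_nonneg (z - w))
  linarith

theorem abs_greenFunction_taylor_le {z w τ : ℂ} (hz : z ∈ unitDisk) (hw : w ∈ unitDisk)
    (hτ : τ ∈ unitDisk) (hτz : τ ≠ z) (hτw : τ ≠ w) {δ : ℝ} (hδ : 0 < δ) (hδ1 : δ ≤ 1) :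
    |greenFunction w τ - greenFunction z τ - 2 * (greenDz z τ * (w - z)).re| ≤
      16 * (δ⁻¹ + 1) * ‖w - z‖ ^ (1 + δ) *
        (‖z - τ‖ ^ (-(1 + δ)) + ‖w - τ‖ ^ (-(1 + δ))) := by
  have z0 : z - τ ≠ 0 := sub_ne_zero.2 hτz.symm
  have w0 : w - τ ≠ 0 := sub_ne_zero.2 hτw.symm
  have z1 := one_sub_mul_conj_ne_zero hz hτ
  have w1 := one_sub_mul_conj_ne_zero hw hτ
  have h1 := abs_log_norm_sub_log_norm_sub_re_le z0 w0 hδ hδ1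
  have h2 := (abs_log_norm_sub_log_norm_sub_re_le z1 w1 hδ hδ1).trans
    (show _ ≤ 4 * (δ⁻¹ + 1) * ‖w - z‖ ^ (1 + δ) *
        (‖z - τ‖ ^ (-(1 + δ)) + ‖w - τ‖ ^ (-(1 + δ))) by
      gcongr 4 * (δ⁻¹ + 1) * ?_ * (?_ + ?_)
      · exact Real.rpow_le_rpow (norm_nonneg _) (norm_one_sub_sub_le z w hτ) (by linarith)
      · exact Real.rpow_le_rpow_of_nonpos (norm_pos_iff.2 z0)
          (norm_sub_le_norm_one_sub_mul_conj hz hτ) (by linarith)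
      · exact Real.rpow_le_rpow_of_nonpos (norm_pos_iff.2 w0)
          (norm_sub_le_norm_one_sub_mul_conj hw hτ) (by linarith))
  rw [sub_sub_sub_cancel_right] at h1
  have e : (greenDz z τ * (w - z)).re = ((w - z) / (z - τ)).re -
      (((1 - w * conj τ) - (1 - z * conj τ)) / (1 - z * conj τ)).re := by
    rw [← Complex.sub_re, greenDz]
    congr 1
    field_simp
    ring
  rw [greenFunction_eq hz hτ hτz, greenFunction_eq hw hτ hτw, e]
  have hp : 0 ≤ (δ⁻¹ + 1) * ‖w - z‖ ^ (1 + δ) *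
        (‖z - τ‖ ^ (-(1 + δ)) + ‖w - τ‖ ^ (-(1 + δ))) := by positivity
  rw [abs_le] at h1 h2 ⊢
  constructor <;> linarith [h1.1, h1.2, h2.1, h2.2]

/-! ### Radial kernels on the plane -/

theorem integrable_norm_rpow_mul_one_add_norm_rpow {s r : ℝ} (hs : s < 2)
    (hsr : 2 < s + r) :
    Integrable (fun x : ℂ => ‖x‖ ^ (-s) * (1 + ‖x‖) ^ (-r)) := by
  -- In polar coordinates the integrand is at most `y ^ (1 - s)` near `0` and `y ^ (1 - s - r)` near
  -- infinity.
  have key : IntegrableOn (fun y : ℝ => y ^ (Module.finrank ℝ ℂ - 1) •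
      (y ^ (-s) * (1 + y) ^ (-r))) (Set.Ioi 0) := by
    rw [← Set.Ioc_union_Ioi_eq_Ioi zero_le_one, Complex.finrank_real_complex]
    have hm : Measurable (fun y : ℝ => y ^ (2 - 1) • (y ^ (-s) * (1 + y) ^ (-r))) := by
      fun_prop
    refine IntegrableOn.union ?_ ?_
    · have h : IntegrableOn (fun y : ℝ => y ^ (1 - s)) (Set.Ioc 0 1) := by
        rw [← intervalIntegrable_iff_integrableOn_Ioc_of_le zero_le_one]
        exact intervalIntegral.intervalIntegrable_rpow' (by linarith)
      refine Integrable.mono' h hm.aestronglyMeasurable ?_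
      filter_upwards [ae_restrict_mem measurableSet_Ioc] with y hy
      have hy0 : 0 < y := hy.1
      have h1 : (1 + y) ^ (-r) ≤ 1 :=
        Real.rpow_le_one_of_one_le_of_nonpos (by linarith) (by linarith)
      have e : y ^ (1 - s) = y * y ^ (-s) := by
        rw [sub_eq_add_neg, Real.rpow_add hy0, Real.rpow_one]
      rw [Real.norm_of_nonneg (by positivity), e, smul_eq_mul, ← mul_assoc, pow_one]
      exact mul_le_of_le_one_right (by positivity) h1
    · have h : IntegrableOn (fun y : ℝ => y ^ (1 - s - r)) (Set.Ioi 1) :=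
        integrableOn_Ioi_rpow_of_lt (by linarith) one_pos
      refine Integrable.mono' h hm.aestronglyMeasurable ?_
      filter_upwards [ae_restrict_mem measurableSet_Ioi] with y hy
      have hy0 : 0 < y := one_pos.trans hy
      have h1 : (1 + y) ^ (-r) ≤ y ^ (-r) :=
        Real.rpow_le_rpow_of_nonpos hy0 (by linarith) (by linarith)
      have e : y ^ (1 - s - r) = y * (y ^ (-s) * y ^ (-r)) := by
        rw [← Real.rpow_add hy0, ← Real.rpow_one_add' hy0.le (by linarith)]
        congr 1
        ring
      rw [Real.norm_of_nonneg (by positivity), e, smul_eq_mul, pow_one]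
      gcongr
  exact (integrable_fun_norm_addHaar (volume : Measure ℂ)
    (f := fun y : ℝ => y ^ (-s) * (1 + y) ^ (-r))).2 key

/-- The kernel `‖x‖ ^ (-s) (h + ‖x‖) ^ (-s)` is integrable, and its integral is homogeneous
in `h`. -/
theorem integrable_norm_rpow_mul_add_norm_rpow {s h : ℝ} (hs1 : 1 < s) (hs : s < 2) (hh : 0 < h) :
    Integrable (fun x : ℂ => ‖x‖ ^ (-s) * (h + ‖x‖) ^ (-s)) ∧
    ∫ x : ℂ, ‖x‖ ^ (-s) * (h + ‖x‖) ^ (-s) =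
      h ^ (2 - 2 * s) * ∫ x : ℂ, ‖x‖ ^ (-s) * (1 + ‖x‖) ^ (-s) := by
  have hI := integrable_norm_rpow_mul_one_add_norm_rpow (s := s) (r := s) hs (by linarith)
  have e : (fun x : ℂ => ‖h • x‖ ^ (-s) * (h + ‖h • x‖) ^ (-s)) =
      fun x : ℂ => h ^ (-(2 * s)) * (‖x‖ ^ (-s) * (1 + ‖x‖) ^ (-s)) := by
    funext x
    rw [norm_smul, Real.norm_of_nonneg hh.le, show h + h * ‖x‖ = h * (1 + ‖x‖) by ring,
      Real.mul_rpow hh.le (norm_nonneg x), Real.mul_rpow hh.le (by positivity),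
      show -(2 * s) = -s + -s by ring, Real.rpow_add hh]
    ring
  refine ⟨?_, ?_⟩
  · rw [← integrable_comp_smul_iff volume _ hh.ne', e]
    exact hI.const_mul _
  · have h1 := Measure.integral_comp_smul (volume : Measure ℂ)
      (fun x : ℂ => ‖x‖ ^ (-s) * (h + ‖x‖) ^ (-s)) h
    rw [e, integral_const_mul, Complex.finrank_real_complex, abs_of_pos (by positivity),
      smul_eq_mul, inv_mul_eq_div, eq_div_iff (by positivity)] at h1
    rw [← h1, sub_eq_add_neg, Real.rpow_add hh, Real.rpow_two]
    ring

/-! ### Hölder's inequality for potentials on the disk -/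

theorem diskArea_le_volume : diskArea ≤ volume := by
  have h1 : (ENNReal.ofReal Real.pi)⁻¹ ≤ 1 := by
    rw [ENNReal.inv_le_one, ENNReal.one_le_ofReal]
    linarith [Real.pi_gt_three]
  intro s
  rw [diskArea, Measure.smul_apply, smul_eq_mul]
  calc _ ≤ 1 * volume.restrict unitDisk s := by gcongr
    _ ≤ _ := by rw [one_mul]; exact Measure.restrict_apply_le _ _

theorem ae_diskArea_mem : ∀ᵐ τ ∂diskArea, τ ∈ unitDisk := by
  have h : ∀ᵐ τ ∂(volume.restrict unitDisk), τ ∈ unitDisk :=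
    ae_restrict_mem Metric.isOpen_ball.measurableSet
  exact Measure.ae_smul_measure h _

theorem ae_diskArea_ne (z : ℂ) : ∀ᵐ τ ∂diskArea, τ ≠ z :=
  (Measure.absolutelyContinuous_of_le diskArea_le_volume).ae_le (Measure.ae_ne volume z)

section Potential

variable {p q : ℝ} {g : ℂ → ℂ}

/-- The majorant is integrated over the whole plane so that translation invariance can make the
bounds uniform in the pole. -/
theorem integrable_mul_norm_and_integral_le (hpq : p.HolderConjugate q)
    (hg : MemLp g (ENNReal.ofReal p) diskArea) {K Ψ : ℂ → ℝ}
    (hK : AEStronglyMeasurable K diskArea) (hK0 : ∀ τ, 0 ≤ K τ) (hΨ0 : ∀ τ, 0 ≤ Ψ τ)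
    (hΨ : Integrable Ψ) (hle : ∀ᵐ τ ∂diskArea, K τ ^ q ≤ Ψ τ) :
    Integrable (fun τ => K τ * ‖g τ‖) diskArea ∧
    ∫ τ, K τ * ‖g τ‖ ∂diskArea ≤
      (∫ τ, Ψ τ) ^ (1 / q) * (∫ τ, ‖g τ‖ ^ p ∂diskArea) ^ (1 / p) := by
  have hΨd : Integrable Ψ diskArea := hΨ.mono_measure diskArea_le_volume
  have hKq : Integrable (fun τ => K τ ^ q) diskArea := by
    refine hΨd.mono' (hK.aemeasurable.pow_const q).aestronglyMeasurable ?_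
    filter_upwards [hle] with τ h
    rwa [Real.norm_of_nonneg (Real.rpow_nonneg (hK0 τ) q)]
  have hKm : MemLp K (ENNReal.ofReal q) diskArea := by
    rw [← integrable_norm_rpow_iff hK (by simpa using hpq.symm.pos) ENNReal.ofReal_ne_top,
      ENNReal.toReal_ofReal hpq.symm.nonneg]
    simpa only [Real.norm_of_nonneg (hK0 _)] using hKq
  have : ENNReal.HolderConjugate (ENNReal.ofReal q) (ENNReal.ofReal p) :=
    hpq.symm.ennrealOfReal
  refine ⟨hKm.integrable_mul hg.norm, ?_⟩
  refine (integral_mul_le_Lp_mul_Lq_of_nonneg hpq.symm (.of_forall hK0)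
    (.of_forall fun _ => norm_nonneg _) hKm hg.norm).trans ?_
  refine mul_le_mul_of_nonneg_right (Real.rpow_le_rpow ?_ ?_ hpq.symm.one_div_nonneg) ?_
  · exact integral_nonneg fun τ => Real.rpow_nonneg (hK0 τ) _
  rotate_left
  · exact Real.rpow_nonneg (integral_nonneg fun _ => Real.rpow_nonneg (norm_nonneg _) _) _
  · exact (integral_mono_ae hKq hΨd hle).trans
      (integral_mono_measure diskArea_le_volume (.of_forall hΨ0) hΨ)

/-- Riesz potentials of order `2 - s` of `L^p` functions are bounded when `s q < 2`. -/
theorem exists_rieszPotential_le (hpq : p.HolderConjugate q)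
    (hg : MemLp g (ENNReal.ofReal p) diskArea) {s : ℝ} (hs : 0 ≤ s) (hsq : s * q < 2) :
    ∃ C : ℝ, 0 ≤ C ∧ ∀ z ∈ unitDisk,
      Integrable (fun τ => ‖z - τ‖ ^ (-s) * ‖g τ‖) diskArea ∧
      ∫ τ, ‖z - τ‖ ^ (-s) * ‖g τ‖ ∂diskArea ≤ C := by
  have hq := hpq.symm.pos
  set Φ : ℂ → ℝ := fun x => ‖x‖ ^ (-(s * q)) * (1 + ‖x‖) ^ (-3 : ℝ) with hΦ
  have hΦ0 : ∀ x, 0 ≤ Φ x := fun x => by positivity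
  have hI : Integrable Φ :=
    integrable_norm_rpow_mul_one_add_norm_rpow hsq (by nlinarith)
  have hN : 0 ≤ ∫ τ, ‖g τ‖ ^ p ∂diskArea :=
    integral_nonneg fun _ => Real.rpow_nonneg (norm_nonneg _) _
  refine ⟨(∫ x, 27 * Φ x) ^ (1 / q) * (∫ τ, ‖g τ‖ ^ p ∂diskArea) ^ (1 / p), ?_, ?_⟩
  · have : 0 ≤ ∫ x, 27 * Φ x := integral_nonneg fun x => by have := hΦ0 x; positivity
    positivity
  intro z hz
  have h := integrable_mul_norm_and_integral_le hpq hg (K := fun τ => ‖z - τ‖ ^ (-s))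
    (Ψ := fun τ => 27 * Φ (z - τ))
    (Measurable.aestronglyMeasurable (by fun_prop)) (fun τ => by positivity)
    (fun τ => mul_nonneg (by norm_num) (hΦ0 _)) ((hI.comp_sub_left z).const_mul 27) ?_
  · rwa [integral_sub_left_eq_self (fun x => 27 * Φ x)] at h
  filter_upwards [ae_diskArea_mem] with τ hτ
  have hz' : ‖z‖ < 1 := by simpa [unitDisk] using hz
  have hτ' : ‖τ‖ < 1 := by simpa [unitDisk] using hτ
  have h3 : 1 + ‖z - τ‖ ≤ 3 := by linarith [norm_sub_le z τ]
  -- On the disk this factor costs only a constant; it supplies decay at infinity, enough even for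
  -- `s = 0`.
  have h4 : (1 : ℝ) ≤ 27 * (1 + ‖z - τ‖) ^ (-3 : ℝ) := by
    calc (1 : ℝ) = 27 * 3 ^ (-3 : ℝ) := by
          rw [Real.rpow_neg (by norm_num)]; norm_num
      _ ≤ _ := by
          refine mul_le_mul_of_nonneg_left ?_ (by norm_num)
          exact Real.rpow_le_rpow_of_nonpos (by positivity) h3 (by norm_num)
  rw [← Real.rpow_mul (norm_nonneg _), neg_mul]
  calc _ = ‖z - τ‖ ^ (-(s * q)) * 1 := (mul_one _).symm
    _ ≤ ‖z - τ‖ ^ (-(s * q)) * (27 * (1 + ‖z - τ‖) ^ (-3 : ℝ)) := by gcongr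
    _ = _ := by simp only [hΦ]; ring

/-- If `a ≤ b` then `h + a ≤ 2a + b ≤ 3b`. This splits a two-pole kernel into two radial ones. -/
theorem inv_mul_inv_rpow_le {a b h q : ℝ} (ha : 0 < a) (hb : 0 < b) (hh : 0 < h)
    (hab : h ≤ a + b) (hq : 0 < q) :
    (a⁻¹ * b⁻¹) ^ q ≤
      3 ^ q * (a ^ (-q) * (h + a) ^ (-q) + b ^ (-q) * (h + b) ^ (-q)) := by
  wlog hle : a ≤ b generalizing a b
  · have := this hb ha (by linarith) (le_of_not_ge hle)
    rwa [mul_comm b⁻¹, add_comm (b ^ (-q) * _)] at this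
  have h1 : b ^ (-q) ≤ ((h + a) / 3) ^ (-q) :=
    Real.rpow_le_rpow_of_nonpos (by positivity) (by linarith) (by linarith)
  rw [Real.div_rpow (by positivity) (by norm_num), Real.rpow_neg (by norm_num : (0 : ℝ) ≤ 3),
    div_inv_eq_mul] at h1
  have h2 : 0 ≤ 3 ^ q * (b ^ (-q) * (h + b) ^ (-q)) := by positivity
  rw [Real.mul_rpow (by positivity) (by positivity), Real.inv_rpow ha.le, Real.inv_rpow hb.le,
    ← Real.rpow_neg ha.le, ← Real.rpow_neg hb.le]
  calc _ ≤ a ^ (-q) * ((h + a) ^ (-q) * 3 ^ q) := by gcongr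
    _ ≤ _ := by linarith

/-- The scale invariant estimate behind the Hölder continuity of the Cauchy transform. -/
theorem exists_integral_inv_mul_inv_le (hpq : p.HolderConjugate q) (hq : q < 2)
    (hg : MemLp g (ENNReal.ofReal p) diskArea) :
    ∃ C : ℝ, 0 ≤ C ∧ ∀ z w : ℂ, z ≠ w →
      Integrable (fun τ => ‖z - τ‖⁻¹ * ‖w - τ‖⁻¹ * ‖g τ‖) diskArea ∧
      ∫ τ, ‖z - τ‖⁻¹ * ‖w - τ‖⁻¹ * ‖g τ‖ ∂diskArea ≤ C * ‖z - w‖ ^ (2 / q - 2) := by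
  have hq0 := hpq.symm.pos
  set I : ℝ := ∫ x : ℂ, ‖x‖ ^ (-q) * (1 + ‖x‖) ^ (-q) with hI
  have hI0 : 0 ≤ I := integral_nonneg fun x => by positivity
  have hN : 0 ≤ ∫ τ, ‖g τ‖ ^ p ∂diskArea :=
    integral_nonneg fun _ => Real.rpow_nonneg (norm_nonneg _) _
  refine ⟨(3 ^ q * (2 * I)) ^ (1 / q) * (∫ τ, ‖g τ‖ ^ p ∂diskArea) ^ (1 / p), by positivity, ?_⟩
  intro z w hzw
  have hh : 0 < ‖z - w‖ := norm_pos_iff.2 (sub_ne_zero.2 hzw)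
  obtain ⟨hint, hval⟩ := integrable_norm_rpow_mul_add_norm_rpow hpq.symm.lt hq hh
  set Φ : ℂ → ℝ := fun x => ‖x‖ ^ (-q) * (‖z - w‖ + ‖x‖) ^ (-q) with hΦ
  have hΦ0 : ∀ x, 0 ≤ Φ x := fun x => by positivity
  have h := integrable_mul_norm_and_integral_le hpq hg (K := fun τ => ‖z - τ‖⁻¹ * ‖w - τ‖⁻¹)
    (Ψ := fun τ => 3 ^ q * (Φ (z - τ) + Φ (w - τ)))
    (by fun_prop) (fun τ => by positivity)
    (fun τ => mul_nonneg (by positivity) (add_nonneg (hΦ0 _) (hΦ0 _)))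
    (((hint.comp_sub_left z).add (hint.comp_sub_left w)).const_mul _) ?_
  · rw [integral_const_mul, integral_add (hint.comp_sub_left z) (hint.comp_sub_left w),
      integral_sub_left_eq_self Φ, integral_sub_left_eq_self Φ, hval] at h
    refine ⟨h.1, h.2.trans_eq ?_⟩
    rw [show (3 : ℝ) ^ q * (‖z - w‖ ^ (2 - 2 * q) * I + ‖z - w‖ ^ (2 - 2 * q) * I) =
      3 ^ q * (2 * I) * ‖z - w‖ ^ (2 - 2 * q) by ring,
      Real.mul_rpow (by positivity) (by positivity), ← Real.rpow_mul hh.le,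
      show (2 - 2 * q) * (1 / q) = 2 / q - 2 by field_simp]
    ring
  filter_upwards [ae_diskArea_ne z, ae_diskArea_ne w] with τ hτz hτw
  refine inv_mul_inv_rpow_le (norm_pos_iff.2 (sub_ne_zero.2 hτz.symm))
    (norm_pos_iff.2 (sub_ne_zero.2 hτw.symm)) hh ?_ hq0
  have := norm_sub_le (z - τ) (w - τ)
  rwa [sub_sub_sub_cancel_right] at this

end Potential

/-! ### Regularity of the Green potential -/

theorem holderOnWith_of_norm_sub_le {E : Type*} [SeminormedAddCommGroup E] {f : ℂ → E}
    {s : Set ℂ} {C μ : ℝ} (hC : 0 ≤ C) (hμ : 0 ≤ μ)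
    (h : ∀ z ∈ s, ∀ w ∈ s, z ≠ w → ‖f z - f w‖ ≤ C * ‖z - w‖ ^ μ) :
    HolderOnWith C.toNNReal μ.toNNReal f s := by
  intro z hz w hw
  rcases eq_or_ne z w with rfl | hzw
  · simp
  rw [edist_dist, edist_dist, dist_eq_norm, dist_eq_norm, Real.coe_toNNReal μ hμ,
    ENNReal.ofReal_rpow_of_nonneg (norm_nonneg _) hμ]
  change _ ≤ ENNReal.ofReal C * _
  rw [← ENNReal.ofReal_mul hC]
  exact ENNReal.ofReal_le_ofReal (h z hz w hw hzw)

theorem hasFDerivAt_of_norm_sub_sub_le {f : ℂ → ℂ} {L : ℂ →L[ℝ] ℂ} {z : ℂ} {C δ : ℝ}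
    (hδ : 0 < δ) (h : ∀ᶠ w in nhds z, ‖f w - f z - L (w - z)‖ ≤ C * ‖w - z‖ ^ (1 + δ)) :
    HasFDerivAt f L z := by
  refine .of_isLittleO ?_
  have h1 : (fun w => f w - f z - L (w - z)) =O[nhds z] fun w => ‖w - z‖ ^ (1 + δ) := by
    refine Asymptotics.IsBigO.of_bound C ?_
    filter_upwards [h] with w hw
    rwa [Real.norm_of_nonneg (by positivity)]
  refine h1.trans_isLittleO ?_
  have h2 : Filter.Tendsto (fun w => ‖w - z‖ ^ δ) (nhds z) (nhds 0) := by
    have : ContinuousAt (fun w : ℂ => ‖w - z‖ ^ δ) z :=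
      (by fun_prop : ContinuousAt (fun w : ℂ => ‖w - z‖) z).rpow_const (.inr hδ.le)
    simpa [ContinuousAt, hδ.ne'] using this
  have h3 := ((Asymptotics.isLittleO_one_iff ℝ).2 h2).mul_isBigO
    (Asymptotics.isBigO_refl (fun w => ‖w - z‖) (nhds z))
  have e : (fun w => ‖w - z‖ ^ (1 + δ)) = fun w => ‖w - z‖ ^ δ * ‖w - z‖ := by
    funext w
    rw [add_comm, Real.rpow_add_one' (norm_nonneg _) (by linarith)]
  rw [e]
  simpa using h3.norm_right

theorem measurable_greenFunction (z : ℂ) : Measurable (greenFunction z) := by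
  have : Measurable fun τ : ℂ => ‖(z - τ) / (1 - conj z * τ)‖ ^ 2 := by fun_prop
  exact Real.measurable_log.comp this

theorem measurable_greenDz (z : ℂ) : Measurable (greenDz z) := by
  have : Measurable fun τ : ℂ => conj τ := Complex.continuous_conj.measurable
  unfold greenDz
  fun_prop

section Potential

variable {p q : ℝ} {g : ℂ → ℂ}

theorem integrable_mul_of_norm_le {K : ℂ → ℂ} {B : ℂ → ℝ}
    (hg : AEStronglyMeasurable g diskArea) (hK : Measurable K)
    (hB : Integrable (fun τ => B τ * ‖g τ‖) diskArea)
    (h : ∀ᵐ τ ∂diskArea, ‖K τ‖ ≤ B τ) :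
    Integrable (fun τ => K τ * g τ) diskArea := by
  refine hB.mono' (hK.aestronglyMeasurable.mul hg) ?_
  filter_upwards [h] with τ h
  rw [norm_mul]
  gcongr

theorem norm_integral_mul_le {K : ℂ → ℂ} {B : ℂ → ℝ}
    (hB : Integrable (fun τ => B τ * ‖g τ‖) diskArea)
    (h : ∀ᵐ τ ∂diskArea, ‖K τ‖ ≤ B τ) :
    ‖∫ τ, K τ * g τ ∂diskArea‖ ≤ ∫ τ, B τ * ‖g τ‖ ∂diskArea := by
  refine norm_integral_le_of_norm_le hB ?_
  filter_upwards [h] with τ h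
  rw [norm_mul]
  gcongr

/-- Two-point singular kernels have uniformly bounded potentials. -/
theorem exists_integral_two_point_le (hpq : p.HolderConjugate q)
    (hg : MemLp g (ENNReal.ofReal p) diskArea) {s : ℝ} (hs : 0 ≤ s) (hsq : s * q < 2) :
    ∃ C : ℝ, 0 ≤ C ∧ ∀ z ∈ unitDisk, ∀ w ∈ unitDisk, ∀ c : ℝ, 0 ≤ c →
      Integrable (fun τ => c * (‖z - τ‖ ^ (-s) + ‖w - τ‖ ^ (-s)) * ‖g τ‖) diskArea ∧
      ∫ τ, c * (‖z - τ‖ ^ (-s) + ‖w - τ‖ ^ (-s)) * ‖g τ‖ ∂diskArea ≤ c * C := by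
  obtain ⟨C, hC, h⟩ := exists_rieszPotential_le hpq hg hs hsq
  refine ⟨2 * C, by positivity, fun z hz w hw c hc => ?_⟩
  have e : (fun τ => c * (‖z - τ‖ ^ (-s) + ‖w - τ‖ ^ (-s)) * ‖g τ‖) =
      fun τ => c * (‖z - τ‖ ^ (-s) * ‖g τ‖ + ‖w - τ‖ ^ (-s) * ‖g τ‖) := by
    funext τ
    ring
  obtain ⟨iz, bz⟩ := h z hz
  obtain ⟨iw, bw⟩ := h w hw
  rw [e]
  refine ⟨(iz.add iw).const_mul c, ?_⟩
  rw [integral_const_mul, integral_add iz iw]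
  gcongr
  linarith

theorem integrable_greenFunction_mul (hpq : p.HolderConjugate q) (hq : q < 3)
    (hg : MemLp g (ENNReal.ofReal p) diskArea) {z : ℂ} (hz : z ∈ unitDisk) :
    Integrable (fun τ : ℂ => (greenFunction z τ : ℂ) * g τ) diskArea := by
  obtain ⟨C, -, hC⟩ := exists_rieszPotential_le hpq hg (s := 1 / 2) (by norm_num) (by linarith)
  refine integrable_mul_of_norm_le hg.1
    (Complex.measurable_ofReal.comp (measurable_greenFunction z))
    (B := fun τ => 8 * ‖z - τ‖ ^ (-(1 / 2) : ℝ)) ?_ ?_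
  · simpa only [mul_assoc] using (hC z hz).1.const_mul 8
  · filter_upwards [ae_diskArea_mem, ae_diskArea_ne z] with τ hτ hτz
    simpa using abs_greenFunction_le hz hτ hτz

theorem exists_norm_greenPotential_sub_le (hpq : p.HolderConjugate q) (hq : q < 3)
    (hg : MemLp g (ENNReal.ofReal p) diskArea) {α : ℝ} (hα : 0 < α) (hα1 : α ≤ 1)
    (hαq : α * q < 2) :
    ∃ C : ℝ, 0 ≤ C ∧ ∀ z ∈ unitDisk, ∀ w ∈ unitDisk, z ≠ w →
      ‖greenPotential g z - greenPotential g w‖ ≤ C * ‖z - w‖ ^ α := by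
  obtain ⟨C, hC, h⟩ := exists_integral_two_point_le hpq hg hα.le hαq
  refine ⟨4 * α⁻¹ * C, by positivity, fun z hz w hw _ => ?_⟩
  obtain ⟨hi, hb⟩ := h z hz w hw (4 * α⁻¹ * ‖z - w‖ ^ α) (by positivity)
  rw [greenPotential, greenPotential, ← integral_sub (integrable_greenFunction_mul hpq hq hg hz)
    (integrable_greenFunction_mul hpq hq hg hw)]
  simp only [← sub_mul]
  refine (norm_integral_mul_le hi ?_).trans (hb.trans_eq (by ring))
  filter_upwards [ae_diskArea_mem, ae_diskArea_ne z, ae_diskArea_ne w] with τ hτ hτz hτw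
  rw [← Complex.ofReal_sub, Complex.norm_real]
  exact abs_greenFunction_sub_le hz hw hτ hτz hτw hα hα1

/-- The real derivative of the Green potential, assembled from its Wirtinger derivatives. -/
noncomputable def greenPotentialDeriv (g : ℂ → ℂ) (z : ℂ) : ℂ →L[ℝ] ℂ :=
  (∫ τ, greenDz z τ * g τ ∂diskArea) • ContinuousLinearMap.id ℝ ℂ +
    (∫ τ, conj (greenDz z τ) * g τ ∂diskArea) • (Complex.conjCLE : ℂ →L[ℝ] ℂ)

theorem greenPotentialDeriv_apply (g : ℂ → ℂ) (z h : ℂ) :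
    greenPotentialDeriv g z h = (∫ τ, greenDz z τ * g τ ∂diskArea) * h +
      (∫ τ, conj (greenDz z τ) * g τ ∂diskArea) * conj h := by
  simp [greenPotentialDeriv]

theorem measurable_conj_greenDz (z : ℂ) : Measurable fun τ => conj (greenDz z τ) :=
  Complex.continuous_conj.measurable.comp (measurable_greenDz z)

theorem integrable_greenDz_mul (hpq : p.HolderConjugate q) (hq : q < 2)
    (hg : MemLp g (ENNReal.ofReal p) diskArea) {z : ℂ} (hz : z ∈ unitDisk) :
    Integrable (fun τ => greenDz z τ * g τ) diskArea ∧
    Integrable (fun τ => conj (greenDz z τ) * g τ) diskArea := by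
  obtain ⟨C, -, hC⟩ := exists_rieszPotential_le hpq hg (s := 1) (by norm_num) (by linarith)
  have hB : Integrable (fun τ => 2 * ‖z - τ‖ ^ (-1 : ℝ) * ‖g τ‖) diskArea := by
    simpa only [mul_assoc] using (hC z hz).1.const_mul 2
  have hle : ∀ᵐ τ ∂diskArea, ‖greenDz z τ‖ ≤ 2 * ‖z - τ‖ ^ (-1 : ℝ) := by
    filter_upwards [ae_diskArea_mem, ae_diskArea_ne z] with τ hτ hτz
    exact norm_greenDz_le hz hτ hτz
  exact ⟨integrable_mul_of_norm_le hg.1 (measurable_greenDz z) hB hle,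
    integrable_mul_of_norm_le hg.1 (measurable_conj_greenDz z) hB
      (by simpa only [RCLike.norm_conj] using hle)⟩

theorem hasFDerivAt_greenPotential (hpq : p.HolderConjugate q) (hq : q < 2)
    (hg : MemLp g (ENNReal.ofReal p) diskArea) {z : ℂ} (hz : z ∈ unitDisk) :
    HasFDerivAt (greenPotential g) (greenPotentialDeriv g z) z := by
  have hq1 := hpq.symm.lt
  -- The gap `q < 2` leaves room for a singularity slightly stronger than `|z - τ|⁻¹`.
  obtain ⟨δ, hδ, hδ1, hδq⟩ : ∃ δ : ℝ, 0 < δ ∧ δ ≤ 1 ∧ (1 + δ) * q < 2 := by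
    refine ⟨(2 - q) / 4, by linarith, by linarith, by nlinarith⟩
  obtain ⟨C, hC, h⟩ := exists_integral_two_point_le hpq hg (s := 1 + δ) (by linarith) hδq
  refine hasFDerivAt_of_norm_sub_sub_le hδ (C := 16 * (δ⁻¹ + 1) * C) ?_
  filter_upwards [Metric.isOpen_ball.mem_nhds hz] with w hw
  obtain ⟨hi, hb⟩ := h z hz w hw (16 * (δ⁻¹ + 1) * ‖w - z‖ ^ (1 + δ)) (by positivity)
  obtain ⟨hA, hB⟩ := integrable_greenDz_mul hpq hq hg hz
  have hGz := integrable_greenFunction_mul hpq (by linarith) hg hz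
  have hGw := integrable_greenFunction_mul hpq (by linarith) hg hw
  -- The kernel is real, so its two Wirtinger terms are conjugate and add up to `2 Re`; only the
  -- kernel's Taylor remainder is left against `g`.
  have e : greenPotential g w - greenPotential g z - greenPotentialDeriv g z (w - z) =
      ∫ τ, ((greenFunction w τ - greenFunction z τ - 2 * (greenDz z τ * (w - z)).re : ℝ) : ℂ) *
        g τ ∂diskArea := by
    have hG : Integrable (fun τ => (greenFunction w τ : ℂ) * g τ - greenFunction z τ * g τ)
        diskArea := hGw.sub hGz
    have hD : Integrable (fun τ => greenDz z τ * g τ * (w - z) +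
        conj (greenDz z τ) * g τ * conj (w - z)) diskArea :=
      (hA.mul_const _).add (hB.mul_const _)
    rw [greenPotentialDeriv_apply, greenPotential, greenPotential, ← integral_mul_const,
      ← integral_mul_const, ← integral_sub hGw hGz,
      ← integral_add (hA.mul_const _) (hB.mul_const _),
      ← integral_sub hG hD]
    refine integral_congr_ae (.of_forall fun τ => ?_)
    have h2 := Complex.add_conj (greenDz z τ * (w - z))
    rw [map_mul] at h2
    simp only [Complex.ofReal_sub, ← h2]
    ring
  rw [e]
  refine (norm_integral_mul_le hi ?_).trans (hb.trans_eq (by ring))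
  filter_upwards [ae_diskArea_mem, ae_diskArea_ne z, ae_diskArea_ne w] with τ hτ hτz hτw
  rw [Complex.norm_real]
  exact abs_greenFunction_taylor_le hz hw hτ hτz hτw hδ hδ1

theorem exists_norm_greenPotentialDeriv_sub_le (hpq : p.HolderConjugate q) (hq : q < 2)
    (hg : MemLp g (ENNReal.ofReal p) diskArea) :
    ∃ C : ℝ, 0 ≤ C ∧ ∀ z ∈ unitDisk, ∀ w ∈ unitDisk, z ≠ w →
      ‖greenPotentialDeriv g z - greenPotentialDeriv g w‖ ≤ C * ‖z - w‖ ^ (2 / q - 1) := by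
  obtain ⟨C, hC, h⟩ := exists_integral_inv_mul_inv_le hpq hq hg
  refine ⟨4 * C, by positivity, fun z hz w hw hzw => ?_⟩
  have hh : 0 < ‖z - w‖ := norm_pos_iff.2 (sub_ne_zero.2 hzw)
  obtain ⟨hi, hb⟩ := h z w hzw
  have hi' : Integrable (fun τ => 2 * ‖z - w‖ * (‖z - τ‖⁻¹ * ‖w - τ‖⁻¹) * ‖g τ‖) diskArea := by
    simpa only [mul_assoc] using hi.const_mul (2 * ‖z - w‖)
  have hb' : ∫ τ, 2 * ‖z - w‖ * (‖z - τ‖⁻¹ * ‖w - τ‖⁻¹) * ‖g τ‖ ∂diskArea ≤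
      2 * C * ‖z - w‖ ^ (2 / q - 1) := by
    have e : ‖z - w‖ ^ (2 / q - 1) = ‖z - w‖ * ‖z - w‖ ^ (2 / q - 2) := by
      rw [← Real.rpow_one_add' hh.le]
      · congr 1
        ring
      · have := hpq.symm.pos
        have : 1 < 2 / q := (one_lt_div this).2 hq
        linarith
    rw [e]
    calc _ = 2 * ‖z - w‖ * ∫ τ, ‖z - τ‖⁻¹ * ‖w - τ‖⁻¹ * ‖g τ‖ ∂diskArea := by
          rw [← integral_const_mul]
          simp only [mul_assoc]
      _ ≤ 2 * ‖z - w‖ * (C * ‖z - w‖ ^ (2 / q - 2)) := by gcongr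
      _ = _ := by ring
  have hle : ∀ᵐ τ ∂diskArea, ‖greenDz z τ - greenDz w τ‖ ≤
      2 * ‖z - w‖ * (‖z - τ‖⁻¹ * ‖w - τ‖⁻¹) := by
    filter_upwards [ae_diskArea_mem, ae_diskArea_ne z, ae_diskArea_ne w] with τ hτ hτz hτw
    exact norm_greenDz_sub_le hz hw hτ hτz hτw
  obtain ⟨hAz, hBz⟩ := integrable_greenDz_mul hpq hq hg hz
  obtain ⟨hAw, hBw⟩ := integrable_greenDz_mul hpq hq hg hw
  have hA : ‖(∫ τ, greenDz z τ * g τ ∂diskArea) - ∫ τ, greenDz w τ * g τ ∂diskArea‖ ≤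
      2 * C * ‖z - w‖ ^ (2 / q - 1) := by
    rw [← integral_sub hAz hAw]
    simp only [← sub_mul]
    exact (norm_integral_mul_le hi' hle).trans hb'
  have hB : ‖(∫ τ, conj (greenDz z τ) * g τ ∂diskArea) -
      ∫ τ, conj (greenDz w τ) * g τ ∂diskArea‖ ≤ 2 * C * ‖z - w‖ ^ (2 / q - 1) := by
    rw [← integral_sub hBz hBw]
    simp only [← sub_mul, ← map_sub]
    exact (norm_integral_mul_le hi' (by simpa only [RCLike.norm_conj] using hle)).trans hb'
  refine ContinuousLinearMap.opNorm_le_bound _ (by positivity) fun x => ?_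
  rw [sub_apply, greenPotentialDeriv_apply, greenPotentialDeriv_apply,
    add_sub_add_comm, ← sub_mul, ← sub_mul]
  refine (norm_add_le _ _).trans ?_
  rw [norm_mul, norm_mul, RCLike.norm_conj, ← add_mul]
  gcongr
  linarith

theorem contDiffOn_one_of_continuousOn_hasFDerivAt {f : ℂ → ℂ} {f' : ℂ → ℂ →L[ℝ] ℂ} {s : Set ℂ}
    (hs : IsOpen s) (hf : ∀ z ∈ s, HasFDerivAt f (f' z) z) (hf' : ContinuousOn f' s) :
    ContDiffOn ℝ 1 f s := by
  rw [show (1 : WithTop ℕ∞) = 0 + 1 by simp, contDiffOn_succ_iff_fderiv_of_isOpen hs]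
  refine ⟨fun z hz => (hf z hz).differentiableAt.differentiableWithinAt, by simp, ?_⟩
  rw [contDiffOn_zero]
  exact hf'.congr fun z hz => (hf z hz).fderiv

end Potential

/-! ### Choice of exponents -/

theorem theorem2 (p : ℝ) (hp : 3 / 2 < p) (g : ℂ → ℂ)
    (hg : MemLp g (ENNReal.ofReal p) diskArea) :
    (∀ z ∈ unitDisk, Integrable (fun τ : ℂ => (greenFunction z τ : ℂ) * g τ) diskArea) ∧
    (p < 2 → MemDiskHolder (2 / p - 1) (greenPotential g)) ∧
    (2 < p → MemDiskC1Holder (1 - 2 / p) (greenPotential g)) := by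
  have hp0 : 0 < p := by linarith
  obtain ⟨q, hpq, hqe⟩ : ∃ q : ℝ, p.HolderConjugate q ∧ q = p / (p - 1) :=
    ⟨_, .conjExponent (by linarith), rfl⟩
  have hp1 : 0 < p - 1 := by linarith
  have hq3 : q < 3 := by
    rw [hqe, div_lt_iff₀ hp1]
    linarith
  refine ⟨fun z hz => integrable_greenFunction_mul hpq hq3 hg hz, fun hp2 => ?_, fun hp2 => ?_⟩
  · have hμ : 0 < 2 / p - 1 := by
      have : 1 < 2 / p := (one_lt_div hp0).2 hp2
      linarith
    have hμ1 : 2 / p - 1 < 1 / 3 := by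
      have : 2 / p < 4 / 3 := by
        rw [div_lt_iff₀ hp0]
        linarith
      linarith
    -- The condition `α q < 2` follows from `α < 1/3` and `q < 3`.
    obtain ⟨C, hC, h⟩ := exists_norm_greenPotential_sub_le hpq hq3 hg hμ (by linarith)
      (by nlinarith [hpq.symm.pos])
    have hH := holderOnWith_of_norm_sub_le hC hμ.le h
    exact ⟨hH.continuousOn (Real.toNNReal_pos.2 hμ), _, hH⟩
  · have hq2 : q < 2 := by
      rw [hqe, div_lt_iff₀ hp1]
      linarith
    have hν : 0 < 1 - 2 / p := by
      have : 2 / p < 1 := (div_lt_one hp0).2 hp2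
      linarith
    have he : 2 / q - 1 = 1 - 2 / p := by
      rw [hqe]
      field_simp
      ring
    obtain ⟨C, hC, h⟩ := exists_norm_greenPotentialDeriv_sub_le hpq hq2 hg
    rw [he] at h
    have hD : ∀ z ∈ unitDisk, HasFDerivAt (greenPotential g) (greenPotentialDeriv g z) z :=
      fun z hz => hasFDerivAt_greenPotential hpq hq2 hg hz
    have hH := holderOnWith_of_norm_sub_le hC hν.le h
    refine ⟨contDiffOn_one_of_continuousOn_hasFDerivAt Metric.isOpen_ball hD
      (hH.continuousOn (Real.toNNReal_pos.2 hν)), C.toNNReal, fun z hz w hw => ?_⟩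
    rw [(hD z hz).fderiv, (hD w hw).fderiv]
    exact hH z hz w hw
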